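/- Let $\mathbb{E}/\mathbb{F}$ be a field extension of finite degree $m=\dim_{\mathbb{F}}(\mathbb{E})\geqslant 2$ (the fields may be infinite). For $k,r\in\mathbb{N}=\{0,1,2,\dots\}$, a subset $S\subseteq\mathbb{E}^{k}$ is called a cutting $r$-blocking set of $\mathbb{E}^{k}$ if for every $\mathbb{E}$-subspace $V$ of $\mathbb{E}^{k}$ with $\dim_{\mathbb{E}}(V)=k-r$, the set $S\cap V$ spans $V$ over $\mathbb{E}$. For $k\geqslant r+1$, let $$\varpi_{\mathbb{E}/\mathbb{F}}(k,r)=\min\{\dim_{\mathbb{F}}(U)\mid U\text{ is an }\mathbb{F}\text{-subspace of }\mathbb{E}^{k}\text{ and a cutting }r\text{-blocking set of }\mathbb{E}^{k}\}.$$ Theorem. Let $r\geqslant 1$ be an integer, and let $(a_i\mid i\geqslant 1)$ be a sequence of non-negative integers such that for all $s\in\mathbb{N}$, $$a_{s+1}^{2}+\Big(m(r-1)+2+\sum_{i=1}^{s}a_i+s\Big)a_{s+1}\geqslant (m-1)\sum_{i=1}^{s}a_i+m-s.$$ Let $w\in\mathbb{N}$, and let $k\in\mathbb{N}$ be such that $k\geqslant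 r+1+\sum_{i=1}^{w}a_i$, $(m-1)(k-r)\geqslant w$ and $$k^{2}-\Big(2r-m(r-1)+\sum_{i=1}^{w}a_i-w\Big)k\geqslant\Big(\sum_{i=1}^{w}a_i+r\Big)\big((m-1)r+w\big)+1.$$ Then, for every $\varepsilon\in\mathbb{N}$ with $\varepsilon\geqslant k$, $$\varpi_{\mathbb{E}/\mathbb{F}}(\varepsilon,r)\geqslant (m-1)r+\varepsilon+w+1.$$ -/

import Mathlib

/-- Let `L` be a finite dimensional left vector space over a division ring `R`. A subset `S` of `L`
is a cutting `r`-blocking set of `L` if every `R`-subspace `V` of `L` of dimension `dim L - r`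
is spanned over `R` by `S ∩ V`. (If `r > dim L` there is no such `V`.) -/
def IsCuttingBlockingSet (R : Type*) {L : Type*} [DivisionRing R] [AddCommGroup L] [Module R L]
    [Module.Finite R L] (r : ℕ) (S : Set L) : Prop :=
  ∀ V : Submodule R L, Module.finrank R V + r = Module.finrank R L →
    Submodule.span R (S ∩ (V : Set L)) = V

/-- The set of all the `F`-dimensions of those `F`-subspaces of the `E`-vector space `E ^ k`
that are cutting `r`-blocking sets of `E ^ k`. -/
def cuttingBlockingDims (F E : Type*) [Field F] [Field E] [Algebra F E] [FiniteDimensional F E]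
    (k r : ℕ) : Set ℕ :=
  {d | ∃ U : Submodule F (Fin k → E),
    IsCuttingBlockingSet E r (U : Set (Fin k → E)) ∧ Module.finrank F U = d}

/-- The whole space is a cutting `r`-blocking set, so the minimum defining `minCuttingDim`
is taken over a nonempty set of natural numbers. -/
theorem cuttingBlockingDims_nonempty (F E : Type*) [Field F] [Field E] [Algebra F E]
    [FiniteDimensional F E] (k r : ℕ) : (cuttingBlockingDims F E k r).Nonempty :=
  ⟨_, ⊤, fun V _ => by simp, rfl⟩

/-- `ϖ_{E/F}(k, r)`: the minimal `F`-dimension of an `F`-subspace of `E ^ k`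
that is a cutting `r`-blocking set of `E ^ k`. -/
noncomputable def minCuttingDim (F E : Type*) [Field F] [Field E] [Algebra F E]
    [FiniteDimensional F E] (k r : ℕ) : ℕ :=
  sInf (cuttingBlockingDims F E k r)

/-! Write `n = (m - 1) r + k + w` and `A = ∑ a i` over `1 ≤ i ≤ w`. A counterexample in dimension
`ε` yields one in dimension `k` of `F`-dimension exactly `n`: divide out `ε - k` independent vectors
of `U`, each costing at least one `F`-dimension, then enlarge the image.

An `F`-subspace missing no point of an `(r + 1)`-dimensional space has dimension at least `m r + 1`
(`exists_avoiding`). Applied to quotients, this bounds `U ∩ W` by `h + w` for every `W` of dimension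
`h = k - r - 1`: `U` is evasive with excess `w`.

Each descent step (`IsEvasive.descend`) lowers the excess by one while lowering `h` by `a (s + 1)`;
otherwise some quotient of `U` would be scattered (excess zero) and too large. The quadratic
condition on the sequence `a` says exactly this. After `w` steps `U` is itself scattered, and
`IsEvasive.succ_mul_finrank_le` gives `(k - r - A) n ≤ m k`, contradicting the condition on `k`. -/

open Module

/-! ### Extending subspaces by vectors of `U`, and dimensions in quotients -/

section Extension

variable {F E L : Type*} [Field F] [Field E] [Algebra F E] [AddCommGroup L] [Module F L]
  [Module E L] [IsScalarTower F E L]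

/-- The `F`-subspace `U` meets every `E`-subspace of dimension `h` in `F`-dimension at most `c`. -/
def IsEvasive (E : Type*) [Field E] [Algebra F E] [Module E L] [IsScalarTower F E L]
    (U : Submodule F L) (h c : ℕ) : Prop :=
  ∀ W : Submodule E L, finrank E W = h → finrank F ↥(U ⊓ W.restrictScalars F) ≤ c

theorem finrank_sup_span_singleton [Module.Finite E L] {W : Submodule E L} {x : L} (hx : x ∉ W) :
    finrank E ↥(W ⊔ Submodule.span E {x}) = finrank E W + 1 := by
  have hlt : W < W ⊔ Submodule.span E {x} := by
    refine lt_of_le_of_ne le_sup_left fun h => hx ?_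
    rw [h]
    exact Submodule.mem_sup_right (Submodule.mem_span_singleton_self x)
  have h1 := Submodule.finrank_lt_finrank_of_lt hlt
  have h2 := Submodule.finrank_add_le_finrank_add_finrank W (Submodule.span E {x})
  have h3 : finrank E (Submodule.span E {x}) ≤ 1 := by
    simpa using finrank_span_le_card (R := E) ({x} : Set L)
  omega

/-- As `U` spans, a proper `E`-subspace always misses some vector of `U`; adjoining it raises the
`E`-dimension by exactly one and the intersection with `U` by at least one. -/
theorem exists_le_finrank_eq_of_span_eq_top [Module.Finite E L] [Module.Finite F L]
    {U : Submodule F L} (hU : Submodule.span E (U : Set L) = ⊤) (W₀ : Submodule E L) (j : ℕ)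
    (hj : finrank E W₀ + j ≤ finrank E L) :
    ∃ W : Submodule E L, W₀ ≤ W ∧ finrank E W = finrank E W₀ + j ∧
      finrank F ↥(U ⊓ W₀.restrictScalars F) + j ≤ finrank F ↥(U ⊓ W.restrictScalars F) := by
  induction j with
  | zero => exact ⟨W₀, le_rfl, rfl, le_rfl⟩
  | succ j ih =>
    obtain ⟨W, hW, hd, hf⟩ := ih (by omega)
    obtain ⟨u, huU, huW⟩ : ∃ u ∈ U, u ∉ W := by
      by_contra! hc
      have : (⊤ : Submodule E L) ≤ W := hU ▸ Submodule.span_le.2 hc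
      rw [top_le_iff.1 this, finrank_top] at hd
      omega
    refine ⟨W ⊔ Submodule.span E {u}, hW.trans le_sup_left, ?_, ?_⟩
    · rw [finrank_sup_span_singleton huW, hd, add_assoc]
    · have hlt : U ⊓ W.restrictScalars F <
          U ⊓ (W ⊔ Submodule.span E {u}).restrictScalars F := by
        refine lt_of_le_of_ne (inf_le_inf_left _ fun x hx => Submodule.mem_sup_left hx)
          fun h => huW ?_
        have : u ∈ U ⊓ (W ⊔ Submodule.span E {u}).restrictScalars F :=
          ⟨huU, Submodule.mem_sup_right (Submodule.mem_span_singleton_self u)⟩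
        rw [← h] at this
        exact this.2
      have := Submodule.finrank_lt_finrank_of_lt hlt
      omega

theorem exists_le_finrank_eq [Module.Finite E L] (W₀ : Submodule E L) (j : ℕ)
    (hj : finrank E W₀ + j ≤ finrank E L) :
    ∃ W : Submodule E L, W₀ ≤ W ∧ finrank E W = finrank E W₀ + j := by
  obtain ⟨W, h1, h2, -⟩ :=
    exists_le_finrank_eq_of_span_eq_top (F := E) (U := ⊤) (by simp) W₀ j hj
  exact ⟨W, h1, h2⟩

theorem finrank_map_add_finrank_inf_ker {M : Type*} [AddCommGroup M] [Module F M]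
    [Module.Finite F L] (f : L →ₗ[F] M) (U : Submodule F L) :
    finrank F ↥(U.map f) + finrank F ↥(U ⊓ LinearMap.ker f) = finrank F U := by
  have h := (f.domRestrict U).finrank_range_add_finrank_ker
  have hker : (LinearMap.ker (f.domRestrict U)).map U.subtype = U ⊓ LinearMap.ker f := by
    ext x
    simp [Submodule.mem_map, and_comm]
  rw [LinearMap.range_domRestrict] at h
  rw [← hker, LinearEquiv.finrank_eq
    (Submodule.equivMapOfInjective U.subtype U.injective_subtype _).symm, h]

theorem finrank_map_mkQ_add [Module.Finite F L] (U : Submodule F L) (W : Submodule E L) :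
    finrank F ↥(U.map (W.mkQ.restrictScalars F)) + finrank F ↥(U ⊓ W.restrictScalars F) =
      finrank F U := by
  have h : LinearMap.ker (W.mkQ.restrictScalars F) = W.restrictScalars F := by
    ext x
    simp
  rw [← finrank_map_add_finrank_inf_ker (W.mkQ.restrictScalars F) U, h]

theorem map_mkQ_inf (U : Submodule F L) (W : Submodule E L) (V : Submodule E (L ⧸ W)) :
    U.map (W.mkQ.restrictScalars F) ⊓ V.restrictScalars F =
      (U ⊓ (V.comap W.mkQ).restrictScalars F).map (W.mkQ.restrictScalars F) := by
  ext x
  constructor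
  · rintro ⟨⟨u, hu, rfl⟩, hx⟩
    exact ⟨u, ⟨hu, hx⟩, rfl⟩
  · rintro ⟨u, ⟨hu, hx⟩, rfl⟩
    exact ⟨⟨u, hu, rfl⟩, hx⟩

theorem finrank_comap_mkQ [Module.Finite E L] (W : Submodule E L) (V : Submodule E (L ⧸ W)) :
    finrank E ↥(V.comap W.mkQ) = finrank E V + finrank E W := by
  have h := finrank_map_mkQ_add (F := E) (V.comap W.mkQ) W
  have h1 : (V.comap W.mkQ).map (W.mkQ.restrictScalars E) = V :=
    Submodule.map_comap_eq_of_surjective W.mkQ_surjective V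
  have h2 : V.comap W.mkQ ⊓ W.restrictScalars E = W :=
    inf_eq_right.2 (Submodule.le_comap_mkQ W V)
  rw [h1, h2] at h
  exact h.symm

theorem span_map_mkQ_eq_top {U : Submodule F L} (hU : Submodule.span E (U : Set L) = ⊤)
    (W : Submodule E L) :
    Submodule.span E (U.map (W.mkQ.restrictScalars F) : Set (L ⧸ W)) = ⊤ := by
  have : (U.map (W.mkQ.restrictScalars F) : Set (L ⧸ W)) = W.mkQ '' U := rfl
  rw [this, Submodule.span_image, hU, Submodule.map_top, Submodule.range_mkQ]

end Extension

/-! ### Scattered subspaces: dimension bound and descent -/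

section Scattered

variable {F E L : Type*} [Field F] [Field E] [Algebra F E] [AddCommGroup L] [Module F L]
  [Module E L] [IsScalarTower F E L] [Module.Finite E L] [Module.Finite F L]

/-- In a scattered subspace, short `F`-independent families are `E`-independent. -/
theorem IsEvasive.linearIndependent {U : Submodule F L}
    (hspan : Submodule.span E (U : Set L) = ⊤) {h : ℕ} (hh : h ≤ finrank E L)
    (hU : IsEvasive E U h h) {s : ℕ} (hs : s ≤ h + 1) {b : Fin s → L} (hb : LinearIndependent F b)
    (hbU : ∀ j, b j ∈ U) : LinearIndependent E b := by
  rw [linearIndependent_iff_card_le_finrank_span, Fintype.card_fin]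
  by_contra! hlt
  set W₀ := Submodule.span E (Set.range b)
  change finrank E W₀ < s at hlt
  -- Enlarging the span by vectors of `U` up to dimension `h` keeps the surplus of `F`-dimension
  -- over `E`-dimension, contradicting evasiveness.
  obtain ⟨W, -, hWd, hWf⟩ :=
    exists_le_finrank_eq_of_span_eq_top hspan W₀ (h - finrank E W₀) (by omega)
  have h1 := hU W (by omega)
  have h2 : s ≤ finrank F ↥(U ⊓ W₀.restrictScalars F) := by
    have h3 : Submodule.span F (Set.range b) ≤ U ⊓ W₀.restrictScalars F := by
      refine Submodule.span_le.2 ?_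
      rintro _ ⟨j, rfl⟩
      exact ⟨hbU j, Submodule.subset_span ⟨j, rfl⟩⟩
    have h4 := Submodule.finrank_mono h3
    rwa [finrank_span_eq_card hb, Fintype.card_fin] at h4
  omega

/-- For `F`-independent scalars `l i`, the map `u ↦ ∑ l i • u i` from `U ^ t` to `L` is injective:
the `u i` span at most `h + 1` dimensions over `F`, so an `F`-basis of their span is
`E`-independent. -/
theorem IsEvasive.mul_finrank_le [FiniteDimensional F E] {U : Submodule F L}
    (hspan : Submodule.span E (U : Set L) = ⊤) {h : ℕ} (hh : h ≤ finrank E L)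
    (hU : IsEvasive E U h h) {t : ℕ} (ht : t ≤ h + 1) (htm : t ≤ finrank F E) :
    t * finrank F U ≤ finrank F L := by
  obtain ⟨l, hl⟩ := exists_linearIndependent_of_le_finrank htm
  let Φ : (Fin t → U) →ₗ[F] L := ∑ i,
    ((Algebra.lsmul F F L (l i)).comp U.subtype).comp (LinearMap.proj i)
  have hΦ : ∀ u, Φ u = ∑ i, l i • (u i : L) := fun u => by simp [Φ]
  have hinj : Function.Injective Φ := by
    rw [← LinearMap.ker_eq_bot, LinearMap.ker_eq_bot']
    intro u hu
    rw [hΦ] at hu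
    let S := Submodule.span F (Set.range u)
    let b := finBasis F S
    have hs : finrank F S ≤ h + 1 := by
      have := finrank_range_le_card (R := F) u
      rw [Fintype.card_fin] at this
      exact this.trans ht
    have hbE : LinearIndependent E fun j => ((b j : U) : L) := by
      refine hU.linearIndependent hspan hh hs ?_ fun j => (b j : U).2
      exact (b.linearIndependent.map' S.subtype S.ker_subtype).map' U.subtype U.ker_subtype
    let v : Fin t → S := fun i => ⟨u i, Submodule.subset_span ⟨i, rfl⟩⟩
    have hv : ∀ i, (u i : L) = ∑ j, b.repr (v i) j • ((b j : U) : L) := fun i => by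
      have := congrArg (U.subtype.comp S.subtype) (b.sum_repr (v i))
      rw [map_sum] at this
      simpa only [map_smul, v, LinearMap.comp_apply, Submodule.subtype_apply] using this.symm
    have hsum : ∑ j, (∑ i, b.repr (v i) j • l i) • ((b j : U) : L) = 0 := by
      rw [← hu]
      simp_rw [Finset.sum_smul]
      rw [Finset.sum_comm]
      refine Finset.sum_congr rfl fun i _ => ?_
      rw [hv i, Finset.smul_sum]
      refine Finset.sum_congr rfl fun j _ => ?_
      rw [smul_assoc, smul_comm]
    have hz := Fintype.linearIndependent_iff.1 hbE _ hsum
    have hc : ∀ i j, b.repr (v i) j = 0 := fun i j =>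
      Fintype.linearIndependent_iff.1 hl (fun i => b.repr (v i) j) (hz j) i
    funext i
    apply Subtype.ext
    rw [hv i]
    simp [hc]
  have := LinearMap.finrank_le_finrank_of_injective hinj
  rwa [finrank_pi_fintype, Finset.sum_const, Finset.card_univ, Fintype.card_fin,
    smul_eq_mul] at this

theorem IsEvasive.succ_mul_finrank_le [FiniteDimensional F E] {U : Submodule F L}
    (hspan : Submodule.span E (U : Set L) = ⊤) {h : ℕ} (hh : h ≤ finrank E L)
    (hU : IsEvasive E U h h) (hdim : finrank E L < finrank F U) :
    (h + 1) * finrank F U ≤ finrank F E * finrank E L := by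
  rw [finrank_mul_finrank F E L]
  rcases le_total (h + 1) (finrank F E) with hle | hle
  · exact hU.mul_finrank_le hspan hh le_rfl hle
  -- With `t = m` the bound would give `dim_F U ≤ dim_E L`, which `hdim` excludes.
  · have h1 := hU.mul_finrank_le hspan hh hle le_rfl
    rw [← finrank_mul_finrank F E L] at h1
    exact absurd (Nat.le_of_mul_le_mul_left h1 finrank_pos) (by omega)

/-- Passing to the quotient by a subspace that meets `U` in too large a dimension gives
a scattered subspace, which violates the bound on dimensions of scattered subspaces. -/
theorem IsEvasive.descend [FiniteDimensional F E] {U : Submodule F L}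
    (hspan : Submodule.span E (U : Set L) = ⊤) {h a e K n : ℕ}
    (hK : finrank E L = h + K) (hn : finrank F U = n + (h + e + 1)) (ha : a ≤ K)
    (hU : IsEvasive E U (h + a) (h + a + e + 1)) (hKn : K < n)
    (hlt : finrank F E * K < (a + 1) * n) : IsEvasive E U h (h + e) := by
  intro W hW
  by_contra! hgt
  -- Extending `W` to dimension `h + a` shows that `U ∩ W` has dimension exactly `h + e + 1`, so the
  -- image of `U` in `L ⧸ W` has dimension `n`.
  obtain ⟨W₁, -, hW₁, hW₁f⟩ := exists_le_finrank_eq_of_span_eq_top hspan W a (by omega)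
  have hd := hU W₁ (by omega)
  have hmap := finrank_map_mkQ_add U W
  have hquot := W.finrank_quotient_add_finrank
  have hev : IsEvasive E (U.map (W.mkQ.restrictScalars F)) a a := by
    intro V hV
    have h1 := hU (V.comap W.mkQ) (by rw [finrank_comap_mkQ]; omega)
    have h2 := finrank_map_mkQ_add (U ⊓ (V.comap W.mkQ).restrictScalars F) W
    have h3 : U ⊓ (V.comap W.mkQ).restrictScalars F ⊓ W.restrictScalars F =
        U ⊓ W.restrictScalars F := by
      rw [inf_assoc]
      congr 1
      exact inf_eq_right.2 (Submodule.le_comap_mkQ W V)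
    rw [map_mkQ_inf]
    rw [h3] at h2
    omega
  have hq : finrank E (L ⧸ W) = K := by omega
  have hn' : finrank F ↥(U.map (W.mkQ.restrictScalars F)) = n := by omega
  have := hev.succ_mul_finrank_le (span_map_mkQ_eq_top hspan W) (by omega) (by omega)
  rw [hq, hn'] at this
  omega

end Scattered

/-! ### Small `F`-subspaces miss a point -/

section Blocking

/-- A linear perturbation of an injective map by a suitable nonzero scalar multiple of another
map stays injective. -/
theorem exists_ne_zero_injective_add_smul {F V W : Type*} [Field F] [Infinite F]
    [AddCommGroup V] [Module F V] [Module.Finite F V] [AddCommGroup W] [Module F W]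
    {f : V →ₗ[F] W} (hf : Function.Injective f) (g : V →ₗ[F] W) :
    ∃ x : F, x ≠ 0 ∧ Function.Injective (f + x • g) := by
  obtain ⟨p, hp⟩ := f.exists_leftInverse_of_injective (LinearMap.ker_eq_bot.2 hf)
  have hp' : ∀ v, p (f v) = v := fun v => LinearMap.congr_fun hp v
  -- A kernel vector of `f - c⁻¹ • g` is an eigenvector of `p ∘ g` for `c`, and only finitely many
  -- `c` are eigenvalues.
  obtain ⟨c, hc⟩ := ((Module.End.finite_spectrum (p.comp g)).union
    (Set.finite_singleton 0)).infinite_compl.nonempty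
  simp only [Set.mem_compl_iff, Set.mem_union, Set.mem_singleton_iff, not_or] at hc
  refine ⟨-c⁻¹, by simpa using hc.2, ?_⟩
  rw [← LinearMap.ker_eq_bot, LinearMap.ker_eq_bot']
  intro v hv
  have h1 : p.comp g v = c • v := by
    have h2 := congrArg p hv
    simp only [LinearMap.add_apply, LinearMap.smul_apply, map_add, map_smul, hp', map_zero] at h2
    rw [neg_smul, add_neg_eq_zero] at h2
    rw [LinearMap.comp_apply]
    conv_rhs => rw [h2, smul_inv_smul₀ hc.2]
  by_contra hv0
  exact hc.1 (Module.End.HasEigenvalue.mem_spectrum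
    (Module.End.hasEigenvalue_of_hasEigenvector ⟨Module.End.mem_eigenspace_iff.2 h1, hv0⟩))

variable {F E L : Type*} [Field F] [Field E] [Algebra F E] [FiniteDimensional F E]
  [AddCommGroup L] [Module F L] [Module E L] [IsScalarTower F E L] [Module.Finite E L]
  [Module.Finite F L]

/-- Over an infinite field, some functional is injective on `U` or maps `U` onto `E`. -/
theorem exists_dual_inf_ker_eq_bot_or_map_eq_top [Infinite F] (U : Submodule F L) :
    ∃ φ : Dual E L, U ⊓ (LinearMap.ker φ).restrictScalars F = ⊥ ∨
      U.map (φ.restrictScalars F) = ⊤ := by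
  -- Take `φ` of maximal `F`-rank on `U`. If both alternatives fail, perturbing `φ` by a multiple of
  -- a `ψ` sending some nonzero `u₀ ∈ U ∩ ker φ` outside the image increases the rank.
  obtain ⟨φ, hφ⟩ : ∃ φ : Dual E L, ∀ ψ : Dual E L,
      finrank F (U.map (ψ.restrictScalars F)) ≤ finrank F (U.map (φ.restrictScalars F)) := by
    have hfin : (Set.range fun ψ : Dual E L => finrank F (U.map (ψ.restrictScalars F))).Finite :=
      (Set.finite_Iic (finrank F E)).subset (by
        rintro _ ⟨ψ, rfl⟩
        exact Submodule.finrank_le _)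
    obtain ⟨_, ⟨φ, rfl⟩, hφ⟩ := hfin.exists_maximalFor id _ ⟨_, ⟨0, rfl⟩⟩
    refine ⟨φ, fun ψ => ?_⟩
    rcases le_total (finrank F (U.map (ψ.restrictScalars F)))
      (finrank F (U.map (φ.restrictScalars F))) with h | h
    · exact h
    · exact hφ ⟨ψ, rfl⟩ h
  refine ⟨φ, ?_⟩
  by_contra! hcon
  obtain ⟨u₀, hu₀, hu₀0⟩ := Submodule.exists_mem_ne_zero_of_ne_bot hcon.1
  obtain ⟨μ, -, hμ⟩ := SetLike.exists_of_lt (lt_top_iff_ne_top.2 hcon.2)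
  obtain ⟨ψ, hψ⟩ : ∃ ψ : Dual E L, ψ u₀ = μ := by
    obtain ⟨ψ, hψ⟩ := not_forall.1 (mt (Module.forall_dual_apply_eq_zero_iff E u₀).1 hu₀0)
    exact ⟨(μ * (ψ u₀)⁻¹) • ψ, by simp [hψ]⟩
  set φF := φ.restrictScalars F with hφF
  set I := U.map φF
  have hφu₀ : φ u₀ = 0 := hu₀.2
  have hsection : ∃ σ : I →ₗ[F] L, (∀ y, σ y ∈ U) ∧ ∀ y, φ (σ y) = y := by
    obtain ⟨σ, hσ⟩ := (φF.submoduleMap U).exists_rightInverse_of_surjective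
      (LinearMap.range_eq_top.2 (φF.submoduleMap_surjective U))
    exact ⟨U.subtype.comp σ, fun y => (σ y).2,
      fun y => congrArg Subtype.val (LinearMap.congr_fun hσ y)⟩
  obtain ⟨σ, hσU, hσ⟩ := hsection
  -- `f` adjoins the new value `μ` to the image `I`; `(f + x • g) (y, c)` is the value of `φ + xψ`
  -- at `σ y + (x⁻¹ * c) • u₀`.
  let f : (I × F) →ₗ[F] E := I.subtype.coprod (LinearMap.toSpanSingleton F E μ)
  let g : (I × F) →ₗ[F] E := ((ψ.restrictScalars F).comp σ).comp (LinearMap.fst F I F)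
  have hf : Function.Injective f := by
    rw [← LinearMap.ker_eq_bot, LinearMap.ker_eq_bot']
    rintro ⟨y, c⟩ hyc
    have hyc' : (y : E) + c • μ = 0 := by simpa [f] using hyc
    have hc : c = 0 := by
      by_contra hc
      refine hμ ((I.smul_mem_iff hc).1 ?_)
      rw [eq_neg_of_add_eq_zero_right hyc']
      exact I.neg_mem y.2
    subst hc
    have hy : y = 0 := by simpa using hyc'
    rw [hy, Prod.mk_zero_zero]
  obtain ⟨x, hx, hinj⟩ := exists_ne_zero_injective_add_smul hf g
  have hle : LinearMap.range (f + x • g) ≤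
      U.map ((φ + algebraMap F E x • ψ).restrictScalars F) := by
    rintro _ ⟨⟨y, c⟩, rfl⟩
    refine ⟨σ y + (x⁻¹ * c) • u₀, U.add_mem (hσU y) (U.smul_mem _ hu₀.1), ?_⟩
    have h1 : ∀ z : L, ∀ b : F, ∀ χ : Dual E L, χ (b • z) = b • χ z := fun z b χ =>
      (χ.restrictScalars F).map_smul b z
    have hxc : x⁻¹ * c * x = c := by rw [mul_right_comm, inv_mul_cancel₀ hx, one_mul]
    simp only [LinearMap.coe_restrictScalars, LinearMap.add_apply, LinearMap.smul_apply, map_add,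
      h1, hσ, hφu₀, hψ, f, g, LinearMap.coprod_apply, LinearMap.comp_apply, LinearMap.fst_apply,
      LinearMap.toSpanSingleton_apply, Submodule.subtype_apply, smul_zero, algebraMap_smul,
      smul_add, smul_smul, hxc]
    abel
  have h1 := Submodule.finrank_mono hle
  rw [LinearMap.finrank_range_of_inj hinj, finrank_prod, finrank_self] at h1
  have h2 := hφ (φ + algebraMap F E x • ψ)
  omega

/-- Over an infinite field, a subspace of small dimension avoids some point of `W`. -/
theorem exists_mem_avoiding_of_infinite [Infinite F] (U : Submodule F L) (r : ℕ)
    (W : Submodule E L) (hW : r < finrank E W)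
    (hU : finrank F ↥(U ⊓ W.restrictScalars F) ≤ finrank F E * r) :
    ∃ v ∈ W, v ≠ 0 ∧ ∀ u ∈ U, u ∈ Submodule.span E {v} → u = 0 := by
  have avoid : ∀ W : Submodule E L, 0 < finrank E W → U ⊓ W.restrictScalars F = ⊥ →
      ∃ v ∈ W, v ≠ 0 ∧ ∀ u ∈ U, u ∈ Submodule.span E {v} → u = 0 := by
    intro W hW hbot
    obtain ⟨v, hvW, hv⟩ := Submodule.exists_mem_ne_zero_of_ne_bot
      (fun h : W = ⊥ => by rw [h, finrank_bot] at hW; exact hW.false)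
    refine ⟨v, hvW, hv, fun u hu huv => ?_⟩
    have : u ∈ U ⊓ W.restrictScalars F :=
      ⟨hu, (Submodule.span_singleton_le_iff_mem v W).2 hvW huv⟩
    rw [hbot] at this
    exact this
  induction r generalizing W with
  | zero => exact avoid W hW (Submodule.finrank_eq_zero.1 (by omega))
  | succ r ih =>
    obtain ⟨φ, hφ⟩ := exists_dual_inf_ker_eq_bot_or_map_eq_top (E := E)
      (U ⊓ W.restrictScalars F)
    have hW' : r < finrank E ↥(W ⊓ LinearMap.ker φ) := by
      have h1 := finrank_map_add_finrank_inf_ker φ W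
      have h2 := (W.map φ).finrank_le
      rw [finrank_self] at h2
      omega
    have hinf : U ⊓ (W ⊓ LinearMap.ker φ).restrictScalars F =
        U ⊓ W.restrictScalars F ⊓ (LinearMap.ker φ).restrictScalars F :=
      (inf_assoc U (W.restrictScalars F) ((LinearMap.ker φ).restrictScalars F)).symm
    obtain ⟨v, hv, h⟩ : ∃ v ∈ W ⊓ LinearMap.ker φ, v ≠ 0 ∧
        ∀ u ∈ U, u ∈ Submodule.span E {v} → u = 0 := by
      -- Either `U` already misses `W ∩ ker φ`, or passing to it costs `U` exactly `m` dimensions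
      -- and the induction continues.
      rcases hφ with hφ | hφ
      · exact avoid _ (by omega) (hinf.trans hφ)
      · refine ih _ hW' ?_
        have h1 := finrank_map_add_finrank_inf_ker (φ.restrictScalars F)
          (U ⊓ W.restrictScalars F)
        rw [hφ, finrank_top] at h1
        rw [hinf]
        change finrank F ↥(U ⊓ W.restrictScalars F ⊓ LinearMap.ker (φ.restrictScalars F)) ≤ _
        rw [mul_add] at hU
        omega
    exact ⟨v, hv.1, h⟩

/-- A subspace of small dimension avoids some point. -/
theorem exists_avoiding (U : Submodule F L) {r : ℕ} (hL : finrank E L = r + 1)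
    (hU : finrank F U ≤ finrank F E * r) :
    ∃ v : L, v ≠ 0 ∧ ∀ u ∈ U, u ∈ Submodule.span E {v} → u = 0 := by
  cases finite_or_infinite F with
  | inr hF =>
    obtain ⟨v, -, h⟩ := exists_mem_avoiding_of_infinite U r (⊤ : Submodule E L)
      (by rw [finrank_top]; omega) (by rw [Submodule.restrictScalars_top, inf_top_eq]; exact hU)
    exact ⟨v, h⟩
  | inl hF =>
    by_contra! hcon
    have : Finite E := Module.finite_of_finite F
    have : Finite L := Module.finite_of_finite F
    have : Nontrivial L := Module.nontrivial_of_finrank_pos (R := E) (by omega)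
    cases nonempty_fintype E
    cases nonempty_fintype L
    cases nonempty_fintype U
    cases nonempty_fintype F
    -- Over a finite field, count: if no point is missed, the `E`-multiples of `U` cover `L`, with
    -- `0` hit repeatedly, so `m + dim_F U > m (r + 1)`.
    let p : E × U → L := fun x => x.1 • (x.2 : L)
    have hsurj : Function.Surjective p := by
      intro v
      rcases eq_or_ne v 0 with rfl | hv
      · exact ⟨(0, 0), by simp [p]⟩
      · obtain ⟨u, huU, huv, hu0⟩ := hcon v hv
        obtain ⟨c, rfl⟩ := Submodule.mem_span_singleton.1 huv
        have hc : c ≠ 0 := fun h => hu0 (by rw [h, zero_smul])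
        exact ⟨(c⁻¹, ⟨_, huU⟩), inv_smul_smul₀ hc v⟩
    have hninj : ¬ Function.Injective p := by
      intro hinj
      obtain ⟨v, hv⟩ := exists_ne (0 : L)
      obtain ⟨u, huU, -, hu0⟩ := hcon v hv
      have h := hinj (a₁ := (0, ⟨u, huU⟩)) (a₂ := (0, 0)) (by simp [p])
      exact hu0 (congrArg (fun x : E × U => (x.2 : L)) h)
    have hcard := Fintype.card_lt_of_surjective_not_injective p hsurj hninj
    rw [Fintype.card_prod, card_eq_pow_finrank (K := F) (V := L),
      card_eq_pow_finrank (K := F) (V := E), card_eq_pow_finrank (K := F) (V := U), ← pow_add,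
      ← finrank_mul_finrank F E L, hL] at hcard
    have := (Nat.pow_lt_pow_iff_right Fintype.one_lt_card).1 hcard
    rw [mul_add] at this
    omega

end Blocking

/-! ### Cutting blocking sets as evasive subspaces -/

section Cutting

variable {F E L : Type*} [Field F] [Field E] [Algebra F E] [AddCommGroup L] [Module F L]
  [Module E L] [IsScalarTower F E L] [Module.Finite E L]

theorem IsCuttingBlockingSet.mono {r : ℕ} {S T : Set L} (hS : IsCuttingBlockingSet E r S)
    (hST : S ⊆ T) : IsCuttingBlockingSet E r T := fun V hV =>
  le_antisymm (Submodule.span_le.2 Set.inter_subset_right)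
    ((hS V hV).ge.trans (Submodule.span_mono (Set.inter_subset_inter_left _ hST)))

/-- Since `r` is less than the dimension, every vector lies in a subspace of codimension `r`. -/
theorem IsCuttingBlockingSet.span_eq_top {r : ℕ} {S : Set L} (hS : IsCuttingBlockingSet E r S)
    (hr : r + 1 ≤ finrank E L) : Submodule.span E S = ⊤ := by
  refine top_le_iff.1 fun v _ => ?_
  have hv : finrank E (Submodule.span E {v}) ≤ 1 := by
    simpa using finrank_span_le_card (R := E) ({v} : Set L)
  obtain ⟨V, hvV, hV⟩ := exists_le_finrank_eq (Submodule.span E {v})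
    (finrank E L - r - finrank E (Submodule.span E {v})) (by omega)
  have h := hS V (by omega)
  have hvV' := hvV (Submodule.mem_span_singleton_self v)
  rw [← h] at hvV'
  exact Submodule.span_mono Set.inter_subset_left hvV'

theorem IsCuttingBlockingSet.map_mkQ {r : ℕ} {U : Submodule F L}
    (hU : IsCuttingBlockingSet E r (U : Set L)) (W : Submodule E L) :
    IsCuttingBlockingSet E r (U.map (W.mkQ.restrictScalars F) : Set (L ⧸ W)) := by
  intro V hV
  have h := hU (V.comap W.mkQ) (by
    rw [finrank_comap_mkQ, ← W.finrank_quotient_add_finrank, ← hV]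
    ring)
  refine le_antisymm (Submodule.span_le.2 Set.inter_subset_right) ?_
  have hV' : Submodule.span E (W.mkQ '' ((U : Set L) ∩ (V.comap W.mkQ))) = V := by
    rw [Submodule.span_image, h, Submodule.map_comap_eq_of_surjective W.mkQ_surjective]
  refine hV'.ge.trans (Submodule.span_mono ?_)
  rintro _ ⟨u, ⟨huU, huV⟩, rfl⟩
  exact ⟨⟨u, huU, rfl⟩, huV⟩

/-- A cutting blocking subspace blocks all points of any quotient of dimension `r + 1`. -/
theorem IsCuttingBlockingSet.finrank_inf_add_le [FiniteDimensional F E] [Module.Finite F L]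
    {r : ℕ}
    {U : Submodule F L} (hU : IsCuttingBlockingSet E r (U : Set L)) {W : Submodule E L}
    (hW : finrank E W + (r + 1) = finrank E L) :
    finrank F ↥(U ⊓ W.restrictScalars F) + (finrank F E * r + 1) ≤ finrank F U := by
  have hmap := finrank_map_mkQ_add U W
  have hquot := W.finrank_quotient_add_finrank
  by_contra! hlt
  -- In a quotient of dimension `r + 1` the subspaces of codimension `r` are the points, so a missed
  -- point contradicts cutting.
  obtain ⟨v, hv0, hv⟩ := exists_avoiding (E := E) (U.map (W.mkQ.restrictScalars F)) (r := r)
    (by omega) (by omega)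
  have h := hU.map_mkQ W (Submodule.span E {v}) (by rw [finrank_span_singleton hv0]; omega)
  have hbot : (U.map (W.mkQ.restrictScalars F) : Set (L ⧸ W)) ∩ Submodule.span E {v} ⊆ {0} :=
    fun u hu => hv u hu.1 hu.2
  have hle : Submodule.span E {v} ≤ ⊥ := h.ge.trans (Submodule.span_le.2 hbot)
  exact hv0 (hle (Submodule.mem_span_singleton_self v))

/-- Iterated descent from a cutting blocking subspace to an evasive subspace with smaller
parameters. -/
theorem IsCuttingBlockingSet.isEvasive_sub_sum [FiniteDimensional F E] [Module.Finite F L]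
    {m r k n w : ℕ}
    (hm : finrank F E = m) (hm2 : 2 ≤ m) (hr : 1 ≤ r) {a : ℕ → ℕ}
    (ha : ∀ s < w, m * (r + 1 + ∑ i ∈ Finset.Icc 1 (s + 1), a i) <
      (a (s + 1) + 1) * (m * r + 1 + s + ∑ i ∈ Finset.Icc 1 (s + 1), a i))
    (hk : r + 1 + ∑ i ∈ Finset.Icc 1 w, a i ≤ k) (hL : finrank E L = k) {U : Submodule F L}
    (hU : IsCuttingBlockingSet E r (U : Set L)) (hn : finrank F U = n)
    (hnk : n + r = m * r + k + w) {s : ℕ} (hs : s ≤ w) :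
    IsEvasive E U (k - r - 1 - ∑ i ∈ Finset.Icc 1 s, a i)
      (k - r - 1 - ∑ i ∈ Finset.Icc 1 s, a i + (w - s)) := by
  induction s with
  | zero =>
    intro W hW
    have h := hU.finrank_inf_add_le (W := W) (by simp at hW; omega)
    simp only [zero_lt_one, Finset.Icc_eq_empty_of_lt, Finset.sum_empty]
    rw [hm] at h
    omega
  | succ s ih =>
    have hle : ∑ i ∈ Finset.Icc 1 (s + 1), a i ≤ ∑ i ∈ Finset.Icc 1 w, a i :=
      Finset.sum_le_sum_of_subset (Finset.Icc_subset_Icc_right hs)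
    have hsum := Finset.sum_Icc_succ_top (show 1 ≤ s + 1 by omega) a
    have hlt := ha s (by omega)
    have ih := ih (by omega)
    have hmr : 2 * r ≤ m * r := Nat.mul_le_mul_right r hm2
    set A := ∑ i ∈ Finset.Icc 1 (s + 1), a i
    set B := ∑ i ∈ Finset.Icc 1 s, a i
    -- `K` is the codimension of the subspaces of the new dimension; `n` here is the dimension left
    -- from `U` modulo one meeting it in one dimension too many.
    refine IsEvasive.descend (a := a (s + 1)) (K := r + 1 + A) (n := m * r + 1 + s + A)
      (hU.span_eq_top (by omega)) (by omega) (by omega) (by omega) ?_ (by omega) (by rwa [hm])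
    have h1 : k - r - 1 - A + a (s + 1) = k - r - 1 - B := by omega
    have h2 : k - r - 1 - B + (w - (s + 1)) + 1 = k - r - 1 - B + (w - s) := by omega
    rw [h1, h2]
    exact ih

/-- After all `w` descents the excess is zero, and `hkq` violates the bound for scattered subspaces.
-/
theorem IsCuttingBlockingSet.finrank_ne [FiniteDimensional F E] [Module.Finite F L]
    {m r k w : ℕ}
    (hm : finrank F E = m) (hm2 : 2 ≤ m) (hr : 1 ≤ r) {a : ℕ → ℕ}
    (ha : ∀ s < w, m * (r + 1 + ∑ i ∈ Finset.Icc 1 (s + 1), a i) <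
      (a (s + 1) + 1) * (m * r + 1 + s + ∑ i ∈ Finset.Icc 1 (s + 1), a i))
    (hk : r + 1 + ∑ i ∈ Finset.Icc 1 w, a i ≤ k) (hL : finrank E L = k) {U : Submodule F L}
    (hU : IsCuttingBlockingSet E r (U : Set L))
    (hkq : m * k < (k - r - ∑ i ∈ Finset.Icc 1 w, a i) * finrank F U) :
    finrank F U + r ≠ m * r + k + w := by
  intro hnk
  have hev := hU.isEvasive_sub_sum hm hm2 hr ha hk hL rfl hnk le_rfl
  rw [Nat.sub_self, add_zero] at hev
  have hmr : 2 * r ≤ m * r := Nat.mul_le_mul_right r hm2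
  have h := hev.succ_mul_finrank_le (hU.span_eq_top (by omega)) (by omega) (by omega)
  have he : k - r - 1 - ∑ i ∈ Finset.Icc 1 w, a i + 1 = k - r - ∑ i ∈ Finset.Icc 1 w, a i := by
    omega
  rw [he, hm, hL] at h
  omega

theorem exists_submodule_ge_finrank_eq [Module.Finite F L] {U : Submodule F L} {n : ℕ} (hU : finrank F U ≤ n)
    (hn : n ≤ finrank F L) : ∃ U' : Submodule F L, U ≤ U' ∧ finrank F U' = n := by
  obtain ⟨U', h, h'⟩ := exists_le_finrank_eq (E := F) U (n - finrank F U) (by omega)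
  exact ⟨U', h, by omega⟩

/-- Passing to a quotient by a subspace spanned by vectors of `U`. -/
theorem IsCuttingBlockingSet.exists_quotient [Module.Finite F L] {r k j : ℕ} (hr : r + 1 ≤ k)
    (hL : finrank E L = k + j) {U : Submodule F L}
    (hU : IsCuttingBlockingSet E r (U : Set L)) :
    ∃ W : Submodule E L, finrank E (L ⧸ W) = k ∧
      finrank F ↥(U.map (W.mkQ.restrictScalars F)) + j ≤ finrank F U := by
  obtain ⟨W, -, hW, hWU⟩ := exists_le_finrank_eq_of_span_eq_top (U := U)
    (hU.span_eq_top (by omega)) ⊥ j (by rw [finrank_bot]; omega)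
  rw [finrank_bot] at hW
  have := finrank_map_mkQ_add U W
  have := W.finrank_quotient_add_finrank
  exact ⟨W, by omega, by omega⟩

end Cutting

/-! ### The main theorem -/

theorem theorem5p2 {F E : Type*} [Field F] [Field E] [Algebra F E] [FiniteDimensional F E]
    (m : ℕ) (hm : Module.finrank F E = m) (hm2 : 2 ≤ m)
    (r : ℕ) (hr : 1 ≤ r)
    (a : ℕ → ℕ) -- only the values `a i` with `1 ≤ i` are used
    (ha : ∀ s : ℕ,
      (m - 1 : ℤ) * (∑ i ∈ Finset.Icc 1 s, (a i : ℤ)) + m - s ≤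
        (a (s + 1) : ℤ) ^ 2 +
          ((m : ℤ) * ((r : ℤ) - 1) + 2 + (∑ i ∈ Finset.Icc 1 s, (a i : ℤ)) + s) * a (s + 1))
    (w k : ℕ)
    (hk : r + 1 + ∑ i ∈ Finset.Icc 1 w, a i ≤ k)
    (hkw : (w : ℤ) ≤ ((m : ℤ) - 1) * ((k : ℤ) - r))
    (hkq : ((∑ i ∈ Finset.Icc 1 w, (a i : ℤ)) + r) * (((m : ℤ) - 1) * r + w) + 1 ≤
      (k : ℤ) ^ 2 -
        (2 * (r : ℤ) - m * ((r : ℤ) - 1) + (∑ i ∈ Finset.Icc 1 w, (a i : ℤ)) - w) * k)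
    (ε : ℕ) (hε : k ≤ ε) :
    ((m : ℤ) - 1) * r + ε + w + 1 ≤ (minCuttingDim F E ε r : ℤ) := by
  by_contra! hlt
  obtain ⟨U, hU, hUd⟩ : minCuttingDim F E ε r ∈ cuttingBlockingDims F E ε r :=
    Nat.sInf_mem (cuttingBlockingDims_nonempty F E ε r)
  rw [← hUd] at hlt
  obtain ⟨n, hn⟩ : ∃ n, n + r = m * r + k + w :=
    ⟨m * r + k + w - r, Nat.sub_add_cancel (by omega)⟩
  obtain ⟨W, hWk, hWU⟩ := hU.exists_quotient (k := k) (j := ε - k) (by omega)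
    (by rw [finrank_fin_fun]; omega)
  -- The descent needs the dimension to be exactly `n`. There is room to enlarge because `hkw` says
  -- `n ≤ m * k`.
  obtain ⟨U', hUU', hU'⟩ := exists_submodule_ge_finrank_eq
    (U := U.map (W.mkQ.restrictScalars F)) (n := n)
    (by zify [hε] at hWU hn ⊢; linarith)
    (by rw [← finrank_mul_finrank F E, hm, hWk]; zify at hn ⊢; linarith)
  refine ((hU.map_mkQ W).mono hUU').finrank_ne hm hm2 hr (a := a) (w := w) (fun s _ => ?_) hk hWk
    ?_ (by rw [hU', hn])
  · have hsum := Finset.sum_Icc_succ_top (show 1 ≤ s + 1 by omega) a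
    -- Expanded over the integers, the strict inequality required for descent is `ha s`; likewise
    -- the last goal below is `hkq`.
    rw [hsum]
    zify
    nlinarith [ha s]
  · rw [hU', Nat.sub_sub]
    zify [show r + ∑ i ∈ Finset.Icc 1 w, a i ≤ k by omega] at hn ⊢
    rw [eq_sub_of_add_eq hn]
    nlinarith [hkq]
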